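/- Let $\mathbb{D}=\{z\in\mathbb{C}:|z|<1\}$ and let $\partial=\frac12\left(\frac{\partial}{\partial x}-i\frac{\partial}{\partial y}\right)$ and $\overline{\partial}=\frac12\left(\frac{\partial}{\partial x}+i\frac{\partial}{\partial y}\right)$ be the Wirtinger derivatives, where $z=x+iy$. If $(\alpha,\beta)\in\mathbb{C}^2$ satisfies $$\left(\frac{|\alpha|^4+4|\alpha\beta|^2+|\beta|^4}{6}\right)^{1/4}\le\frac{2}{\pi},$$ then there is a (complex-valued) harmonic function $f\colon\mathbb{D}\to\mathbb{D}$ with $f(0)=0$, $\partial f(0)=\alpha$ and $\overline{\partial}f(0)=\beta$. The constant $2/\pi$ is sharp: for every real $C>2/\pi$ there is $(\alpha,\beta)\in\mathbb{C}^2$ with $\left(\frac{|\alpha|^4+4|\alpha\beta|^2+|\beta|^4}{6}\right)^{1/4}\le C$ for which no harmonic $f\colon\mathbb{D}\to\mathbb{D}$ satisfies $f(0)=0$, $\partial f(0)=\alpha$ and $\overline{\partial}f(0)=\beta$. -/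

import Mathlib

open Metric InnerProductSpace

/-- The Wirtinger derivative `∂f = (1/2)(∂f/∂x - i ∂f/∂y)` at the point `z`, where the partial
derivatives are the real Fréchet derivative evaluated in the directions `1` and `i`. -/
noncomputable def wirtinger (f : ℂ → ℂ) (z : ℂ) : ℂ :=
  (1 / 2 : ℂ) * (fderiv ℝ f z 1 - Complex.I * fderiv ℝ f z Complex.I)

/-- The conjugate Wirtinger derivative `(1/2)(∂f/∂x + i ∂f/∂y)` at the point `z`. -/
noncomputable def wirtingerBar (f : ℂ → ℂ) (z : ℂ) : ℂ :=
  (1 / 2 : ℂ) * (fderiv ℝ f z 1 + Complex.I * fderiv ℝ f z Complex.I)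

open MeasureTheory intervalIntegral Set Filter Topology
open scoped Real Interval

/-! For k in [-1, 1], let the boundary map send e^{iθ} to the direction of cos θ + i k sin θ. Its
Poisson extension is a harmonic self-map of the disk fixing 0, with Wirtinger derivatives (P + Q)/2
and (P - Q)/2 at 0, where P = `ellipseCos k` and Q = `ellipseSin k`. As k goes from -1 to 1 this
pair moves from (0, 1) to (1, 0), so it meets every ray of the closed first quadrant. Rotations of
source and target adjust the arguments of α and β, and contracting the target shrinks the pair.
Existence therefore follows once the curve stays outside the open quartic ball.

On the curve the quartic form is (3P⁴ + 2P²Q² + 3Q⁴)/8. It is even in k, and k = 0 gives the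
boundary point (2/π, 2/π), so it suffices that it increases on [0, 1]
(`monotoneOn_ellipse_quartic`). Since P' = -kJ and Q' = J with J = `ellipseSlope k` ≥ 0, this
reduces to k ≤ H(r), where r = Q/P and H(r) = r(1 + 3r²)/(3 + r²). The ratio r solves a Riccati
equation, and comparison backwards from k = 1, where H(r) = k, gives the inequality
(`mul_le_of_ellipse`).

For sharpness take α = β = C: then Re f has x-derivative 2C at 0, which the Poisson formula bounds
by 4/π. -/

/-- The modulus of `cos θ + i k sin θ`. -/
noncomputable def ellipseRadius (k θ : ℝ) : ℝ := √(Real.cos θ ^ 2 + k ^ 2 * Real.sin θ ^ 2)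

/-- The first cosine coefficient of the real part of the normalized ellipse parametrization. -/
noncomputable def ellipseCos (k : ℝ) : ℝ :=
  π⁻¹ * ∫ θ in (0 : ℝ)..2 * π, Real.cos θ ^ 2 / ellipseRadius k θ

/-- The first sine coefficient of the imaginary part of the normalized ellipse parametrization. -/
noncomputable def ellipseSin (k : ℝ) : ℝ :=
  π⁻¹ * ∫ θ in (0 : ℝ)..2 * π, k * Real.sin θ ^ 2 / ellipseRadius k θ

/-- The derivative of `ellipseSin`. -/
noncomputable def ellipseSlope (k : ℝ) : ℝ :=
  π⁻¹ * ∫ θ in (0 : ℝ)..2 * π, Real.sin θ ^ 2 * Real.cos θ ^ 2 / ellipseRadius k θ ^ 3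

/-! ### Bounds for the radius. -/

lemma ellipseRadius_nonneg (k θ : ℝ) : 0 ≤ ellipseRadius k θ := Real.sqrt_nonneg _

lemma ellipseRadius_sq (k θ : ℝ) :
    ellipseRadius k θ ^ 2 = Real.cos θ ^ 2 + k ^ 2 * Real.sin θ ^ 2 :=
  Real.sq_sqrt (by positivity)

lemma ellipseRadius_neg (k θ : ℝ) : ellipseRadius (-k) θ = ellipseRadius k θ := by
  simp [ellipseRadius]

lemma ellipseRadius_one (θ : ℝ) : ellipseRadius 1 θ = 1 := by
  simp [ellipseRadius]

lemma ellipseRadius_zero (θ : ℝ) : ellipseRadius 0 θ = |Real.cos θ| := by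
  simp [ellipseRadius, Real.sqrt_sq_eq_abs]

lemma abs_cos_le_ellipseRadius (k θ : ℝ) : |Real.cos θ| ≤ ellipseRadius k θ :=
  Real.abs_le_sqrt (le_add_of_nonneg_right (by positivity))

lemma abs_mul_sin_le_ellipseRadius (k θ : ℝ) : |k * Real.sin θ| ≤ ellipseRadius k θ := by
  refine Real.abs_le_sqrt ?_
  rw [mul_pow]
  exact le_add_of_nonneg_left (by positivity)

lemma le_ellipseRadius {m k θ : ℝ} (hm : m ≤ 1) (h : 0 ≤ m) (hk : m ≤ |k|) :
    m ≤ ellipseRadius k θ := by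
  refine Real.le_sqrt_of_sq_le ?_
  have h1 : m ^ 2 ≤ k ^ 2 := by rw [← sq_abs k]; gcongr
  have h2 : m ^ 2 ≤ 1 := by nlinarith
  nlinarith [Real.sin_sq_add_cos_sq θ, sq_nonneg (Real.sin θ), sq_nonneg (Real.cos θ)]

lemma ellipseRadius_pos {k : ℝ} (hk : k ≠ 0) (θ : ℝ) : 0 < ellipseRadius k θ :=
  (lt_min one_pos (abs_pos.2 hk)).trans_le
    (le_ellipseRadius (min_le_left _ _) (by positivity) (min_le_right _ _))

lemma ellipseRadius_pos_of_cos_ne_zero (k : ℝ) {θ : ℝ} (h : Real.cos θ ≠ 0) :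
    0 < ellipseRadius k θ :=
  (abs_pos.2 h).trans_le (abs_cos_le_ellipseRadius k θ)

lemma continuous_ellipseRadius (k : ℝ) : Continuous (ellipseRadius k) := by
  unfold ellipseRadius; fun_prop

lemma continuous_ellipseRadius_left (θ : ℝ) : Continuous (ellipseRadius · θ) := by
  unfold ellipseRadius; fun_prop

lemma abs_cos_sq_div_ellipseRadius_le (k θ : ℝ) :
    |Real.cos θ ^ 2 / ellipseRadius k θ| ≤ 1 := by
  rw [abs_div, abs_of_nonneg (ellipseRadius_nonneg k θ)]
  refine div_le_one_of_le₀ ?_ (ellipseRadius_nonneg k θ)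
  rw [abs_pow]
  exact (pow_le_of_le_one (abs_nonneg _) (Real.abs_cos_le_one θ) two_ne_zero).trans
    (abs_cos_le_ellipseRadius k θ)

lemma abs_mul_sin_sq_div_ellipseRadius_le (k θ : ℝ) :
    |k * Real.sin θ ^ 2 / ellipseRadius k θ| ≤ 1 := by
  rw [abs_div, abs_of_nonneg (ellipseRadius_nonneg k θ)]
  refine div_le_one_of_le₀ ?_ (ellipseRadius_nonneg k θ)
  rw [pow_two, ← mul_assoc, abs_mul]
  exact (mul_le_of_le_one_right (abs_nonneg _) (Real.abs_sin_le_one θ)).trans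
    (abs_mul_sin_le_ellipseRadius k θ)

/-! ### Regularity of the coefficients in k. -/

lemma ae_cos_ne_zero : ∀ᵐ θ : ℝ, Real.cos θ ≠ 0 := by
  have : {θ : ℝ | Real.cos θ = 0}.Countable := by
    refine (countable_range fun n : ℤ ↦ (2 * n + 1) * π / 2).mono fun θ hθ ↦ ?_
    obtain ⟨n, hn⟩ := Real.cos_eq_zero_iff.1 hθ
    exact ⟨n, hn.symm⟩
  filter_upwards [this.ae_notMem volume] with θ hθ using hθ

/-- Dominated convergence reaches the degenerate value k = 0, because the radius vanishes there only
on the null set cos θ = 0. -/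
lemma continuous_ellipseCos : Continuous ellipseCos := by
  refine continuous_const.mul (continuous_of_dominated_interval (bound := fun _ ↦ 1)
    (fun k ↦ ?_) (fun k ↦ ?_) (by simp) ?_)
  · exact ((by fun_prop : Measurable fun θ : ℝ ↦ Real.cos θ ^ 2).div
      (continuous_ellipseRadius k).measurable).aestronglyMeasurable
  · exact Eventually.of_forall fun θ _ ↦ abs_cos_sq_div_ellipseRadius_le k θ
  · filter_upwards [ae_cos_ne_zero] with θ hθ _
    exact continuous_const.div (continuous_ellipseRadius_left θ)
      fun k ↦ (ellipseRadius_pos_of_cos_ne_zero k hθ).ne'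

lemma continuous_ellipseSin : Continuous ellipseSin := by
  refine continuous_const.mul (continuous_of_dominated_interval (bound := fun _ ↦ 1)
    (fun k ↦ ?_) (fun k ↦ ?_) (by simp) ?_)
  · exact ((by fun_prop : Measurable fun θ : ℝ ↦ k * Real.sin θ ^ 2).div
      (continuous_ellipseRadius k).measurable).aestronglyMeasurable
  · exact Eventually.of_forall fun θ _ ↦ abs_mul_sin_sq_div_ellipseRadius_le k θ
  · filter_upwards [ae_cos_ne_zero] with θ hθ _
    exact (by fun_prop : Continuous fun k : ℝ ↦ k * Real.sin θ ^ 2).div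
      (continuous_ellipseRadius_left θ) fun k ↦ (ellipseRadius_pos_of_cos_ne_zero k hθ).ne'

lemma hasDerivAt_ellipseRadius_left {k : ℝ} (hk : k ≠ 0) (θ : ℝ) :
    HasDerivAt (ellipseRadius · θ) (k * Real.sin θ ^ 2 / ellipseRadius k θ) k := by
  have h : HasDerivAt (fun k : ℝ ↦ Real.cos θ ^ 2 + k ^ 2 * Real.sin θ ^ 2)
      (2 * k * Real.sin θ ^ 2) k := by
    simpa using ((hasDerivAt_pow 2 k).mul_const (Real.sin θ ^ 2)).const_add (Real.cos θ ^ 2)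
  have h0 : Real.cos θ ^ 2 + k ^ 2 * Real.sin θ ^ 2 ≠ 0 := by
    rw [← ellipseRadius_sq]; exact (pow_pos (ellipseRadius_pos hk θ) 2).ne'
  refine (h.sqrt h0).congr_deriv ?_
  rw [← ellipseRadius]
  have := (ellipseRadius_pos hk θ).ne'
  field_simp

lemma hasDerivAt_integral_div_ellipseRadius {k : ℝ} (hk : k ∈ Ioo (0 : ℝ) 1) {u v : ℝ → ℝ → ℝ}
    (hu : ∀ k, Continuous (u k)) (hv : ∀ k, Continuous (v k))
    (hv1 : ∀ k ∈ Ioo (0 : ℝ) 2, ∀ θ, |v k θ| ≤ 2)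
    (h : ∀ k, 0 < k → ∀ θ, HasDerivAt (fun k ↦ u k θ / ellipseRadius k θ)
      (v k θ / ellipseRadius k θ ^ 3) k) :
    HasDerivAt (fun k ↦ ∫ θ in (0 : ℝ)..2 * π, u k θ / ellipseRadius k θ)
      (∫ θ in (0 : ℝ)..2 * π, v k θ / ellipseRadius k θ ^ 3) k := by
  obtain ⟨hk0, hk1⟩ := hk
  refine (intervalIntegral.hasDerivAt_integral_of_dominated_loc_of_deriv_le
    (F := fun k θ ↦ u k θ / ellipseRadius k θ) (F' := fun k θ ↦ v k θ / ellipseRadius k θ ^ 3)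
    -- On the parameter interval (k/2, 2) the radius is at least k/2.
    (bound := fun _ ↦ 2 / (k / 2) ^ 3) (Ioo_mem_nhds (half_lt_self hk0) (hk1.trans one_lt_two))
    (Eventually.of_forall fun x ↦ ?_) ?_ ?_ ?_ ?_ ?_).2
  · exact ((hu x).measurable.div (continuous_ellipseRadius x).measurable).aestronglyMeasurable
  · exact ((hu k).div (continuous_ellipseRadius k)
      fun θ ↦ (ellipseRadius_pos hk0.ne' θ).ne').intervalIntegrable _ _
  · exact ((hv k).measurable.div
      ((continuous_ellipseRadius k).measurable.pow_const 3)).aestronglyMeasurable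
  · refine Eventually.of_forall fun θ _ x hx ↦ ?_
    have hx0 : 0 < x := (half_pos hk0).trans hx.1
    have hr : k / 2 ≤ ellipseRadius x θ :=
      le_ellipseRadius (by linarith) (by positivity) (by rw [abs_of_pos hx0]; exact hx.1.le)
    rw [Real.norm_eq_abs, abs_div, abs_of_nonneg (pow_nonneg (ellipseRadius_nonneg x θ) 3)]
    gcongr
    exact hv1 x ⟨hx0, hx.2⟩ θ
  · exact intervalIntegrable_const
  · exact Eventually.of_forall fun θ _ x hx ↦ h x ((half_pos hk0).trans hx.1) θ

lemma sin_sq_mul_cos_sq_le_one (θ : ℝ) : Real.sin θ ^ 2 * Real.cos θ ^ 2 ≤ 1 :=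
  mul_le_one₀ (Real.sin_sq_le_one θ) (sq_nonneg _) (Real.cos_sq_le_one θ)

lemma hasDerivAt_ellipseCos {k : ℝ} (hk : k ∈ Ioo (0 : ℝ) 1) :
    HasDerivAt ellipseCos (-(k * ellipseSlope k)) k := by
  have key := hasDerivAt_integral_div_ellipseRadius hk (u := fun _ θ ↦ Real.cos θ ^ 2)
    (v := fun k θ ↦ -(k * (Real.sin θ ^ 2 * Real.cos θ ^ 2))) (fun _ ↦ by fun_prop)
    (fun _ ↦ by fun_prop) ?_ ?_
  · refine (key.const_mul π⁻¹).congr_deriv ?_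
    simp only [ellipseSlope, ← neg_mul, mul_div_assoc, intervalIntegral.integral_const_mul]
    ring
  · intro k hk θ
    rw [abs_neg, abs_of_nonneg (mul_nonneg hk.1.le (by positivity))]
    nlinarith [sin_sq_mul_cos_sq_le_one θ, hk.1, hk.2,
      mul_nonneg (sq_nonneg (Real.sin θ)) (sq_nonneg (Real.cos θ))]
  · intro k hk θ
    have hr := ellipseRadius_pos hk.ne' θ
    refine ((hasDerivAt_const k (Real.cos θ ^ 2)).div
      (hasDerivAt_ellipseRadius_left hk.ne' θ) hr.ne').congr_deriv ?_
    field_simp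
    ring

lemma hasDerivAt_ellipseSin {k : ℝ} (hk : k ∈ Ioo (0 : ℝ) 1) :
    HasDerivAt ellipseSin (ellipseSlope k) k := by
  refine (hasDerivAt_integral_div_ellipseRadius hk (u := fun k θ ↦ k * Real.sin θ ^ 2)
    (v := fun k θ ↦ Real.sin θ ^ 2 * Real.cos θ ^ 2) (fun _ ↦ by fun_prop)
    (fun _ ↦ by fun_prop) ?_ ?_).const_mul π⁻¹
  · intro k hk θ
    rw [abs_of_nonneg (by positivity)]
    linarith [sin_sq_mul_cos_sq_le_one θ]
  · intro k hk θ
    have hr := ellipseRadius_pos hk.ne' θ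
    refine (((hasDerivAt_id' k).mul_const (Real.sin θ ^ 2)).div
      (hasDerivAt_ellipseRadius_left hk.ne' θ) hr.ne').congr_deriv ?_
    have h2 := ellipseRadius_sq k θ
    field_simp
    rw [h2]
    ring

lemma ellipseSlope_nonneg (k : ℝ) : 0 ≤ ellipseSlope k := by
  refine mul_nonneg (by positivity) (intervalIntegral.integral_nonneg (by positivity) fun θ _ ↦ ?_)
  have := ellipseRadius_nonneg k θ
  positivity

lemma hasDerivAt_ellipseRadius {k : ℝ} (hk : k ≠ 0) (θ : ℝ) :
    HasDerivAt (ellipseRadius k)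
      ((k ^ 2 - 1) * (Real.sin θ * Real.cos θ) / ellipseRadius k θ) θ := by
  have h : HasDerivAt (fun θ : ℝ ↦ Real.cos θ ^ 2 + k ^ 2 * Real.sin θ ^ 2)
      (2 * ((k ^ 2 - 1) * (Real.sin θ * Real.cos θ))) θ := by
    refine (((Real.hasDerivAt_cos θ).pow 2).add
      (((Real.hasDerivAt_sin θ).pow 2).const_mul (k ^ 2))).congr_deriv ?_
    push_cast
    ring
  have h0 : Real.cos θ ^ 2 + k ^ 2 * Real.sin θ ^ 2 ≠ 0 := by
    rw [← ellipseRadius_sq]; exact (pow_pos (ellipseRadius_pos hk θ) 2).ne'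
  refine (h.sqrt h0).congr_deriv ?_
  rw [← ellipseRadius]
  have := (ellipseRadius_pos hk θ).ne'
  field_simp

/-- The θ-derivative of sin θ cos θ / R integrates to zero over a period. This expresses the slope
through the two coefficients and so closes the differential system for them. -/
lemma one_sub_sq_mul_ellipseSlope {k : ℝ} (hk : k ≠ 0) :
    (1 - k ^ 2) * ellipseSlope k = ellipseSin k / k - ellipseCos k := by
  have hr := fun θ ↦ ellipseRadius_pos hk θ
  have hc := continuous_ellipseRadius k
  have hne := fun θ ↦ (hr θ).ne'
  have c1 : Continuous fun θ ↦ Real.cos θ ^ 2 / ellipseRadius k θ :=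
    (by fun_prop : Continuous fun θ : ℝ ↦ Real.cos θ ^ 2).div hc hne
  have c2 : Continuous fun θ ↦ k * Real.sin θ ^ 2 / ellipseRadius k θ :=
    (by fun_prop : Continuous fun θ : ℝ ↦ k * Real.sin θ ^ 2).div hc hne
  have c3 : Continuous fun θ ↦ Real.sin θ ^ 2 * Real.cos θ ^ 2 / ellipseRadius k θ ^ 3 :=
    (by fun_prop : Continuous fun θ : ℝ ↦ Real.sin θ ^ 2 * Real.cos θ ^ 2).div (hc.pow 3)
      fun θ ↦ pow_ne_zero 3 (hne θ)
  have hd : ∀ θ ∈ [[(0 : ℝ), 2 * π]], HasDerivAt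
      (fun θ ↦ Real.sin θ * Real.cos θ / ellipseRadius k θ)
      (Real.cos θ ^ 2 / ellipseRadius k θ - k⁻¹ * (k * Real.sin θ ^ 2 / ellipseRadius k θ)
        + (1 - k ^ 2) * (Real.sin θ ^ 2 * Real.cos θ ^ 2 / ellipseRadius k θ ^ 3)) θ := by
    intro θ _
    refine (((Real.hasDerivAt_sin θ).mul (Real.hasDerivAt_cos θ)).div
      (hasDerivAt_ellipseRadius hk θ) (hne θ)).congr_deriv ?_
    have := hne θ
    simp only [Pi.mul_apply]
    field_simp
    ring
  have i1 := c1.intervalIntegrable (μ := volume) 0 (2 * π)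
  have i2 := (c2.intervalIntegrable (μ := volume) 0 (2 * π)).const_mul k⁻¹
  have i3 := (c3.intervalIntegrable (μ := volume) 0 (2 * π)).const_mul (1 - k ^ 2)
  have h := integral_eq_sub_of_hasDerivAt hd ((i1.sub i2).add i3)
  rw [intervalIntegral.integral_add (i1.sub i2) i3, intervalIntegral.integral_sub i1 i2,
    intervalIntegral.integral_const_mul, intervalIntegral.integral_const_mul] at h
  simp only [Real.sin_two_pi, Real.sin_zero, zero_mul, zero_div, sub_self] at h
  rw [ellipseSlope, ellipseSin, ellipseCos, div_eq_mul_inv]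
  linear_combination π⁻¹ * h

/-! ### Symmetry, special values and monotonicity of the coefficients. -/

lemma ellipseCos_neg (k : ℝ) : ellipseCos (-k) = ellipseCos k := by
  simp [ellipseCos, ellipseRadius_neg]

lemma ellipseSin_neg (k : ℝ) : ellipseSin (-k) = -ellipseSin k := by
  simp [ellipseSin, ellipseRadius_neg, neg_div]

lemma ellipseSin_zero : ellipseSin 0 = 0 := by simp [ellipseSin]

lemma ellipseCos_one : ellipseCos 1 = 1 := by
  simp [ellipseCos, ellipseRadius_one, Real.pi_ne_zero]

lemma ellipseSin_one : ellipseSin 1 = 1 := by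
  simp [ellipseSin, ellipseRadius_one, Real.pi_ne_zero]

lemma integral_abs_cos : ∫ θ in (0 : ℝ)..2 * π, |Real.cos θ| = 4 := by
  have hp : Function.Periodic (fun θ ↦ |Real.cos θ|) (2 * π) := fun θ ↦ by simp
  have h := hp.intervalIntegral_add_eq 0 (-(π / 2))
  rw [zero_add] at h
  have hi : ∀ a b, IntervalIntegrable (fun θ ↦ |Real.cos θ|) volume a b :=
    fun a b ↦ Real.continuous_cos.abs.intervalIntegrable a b
  have h1 : ∫ θ in (-(π / 2))..(π / 2), |Real.cos θ| = 2 := by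
    rw [intervalIntegral.integral_congr (g := Real.cos), integral_cos]
    · simp; norm_num
    · intro θ hθ
      rw [uIcc_of_le (by linarith [Real.pi_pos])] at hθ
      exact abs_of_nonneg (Real.cos_nonneg_of_mem_Icc hθ)
  have h2 : ∫ θ in (π / 2)..(-(π / 2) + 2 * π), |Real.cos θ| = 2 := by
    rw [intervalIntegral.integral_congr (g := fun θ ↦ -Real.cos θ),
      intervalIntegral.integral_neg, integral_cos]
    · rw [show -(π / 2) + 2 * π = π / 2 + π by ring, Real.sin_add_pi]
      simp; norm_num
    · intro θ hθ
      rw [uIcc_of_le (by linarith [Real.pi_pos])] at hθ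
      exact abs_of_nonpos (Real.cos_nonpos_of_pi_div_two_le_of_le hθ.1 (by linarith [hθ.2]))
  rw [h, ← intervalIntegral.integral_add_adjacent_intervals (hi _ (π / 2)) (hi _ _), h1, h2]
  norm_num

lemma ellipseCos_zero : ellipseCos 0 = 4 / π := by
  have : ∀ θ, Real.cos θ ^ 2 / ellipseRadius 0 θ = |Real.cos θ| := fun θ ↦ by
    rw [ellipseRadius_zero, ← sq_abs, pow_two, mul_self_div_self]
  simp only [ellipseCos, this, integral_abs_cos]
  ring

lemma monotoneOn_ellipseSin : MonotoneOn ellipseSin (Icc 0 1) := by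
  refine monotoneOn_of_hasDerivWithinAt_nonneg (convex_Icc 0 1)
    continuous_ellipseSin.continuousOn (f' := ellipseSlope) ?_ fun k _ ↦ ellipseSlope_nonneg k
  rw [interior_Icc]
  exact fun k hk ↦ (hasDerivAt_ellipseSin hk).hasDerivWithinAt

lemma antitoneOn_ellipseCos : AntitoneOn ellipseCos (Icc 0 1) := by
  refine antitoneOn_of_hasDerivWithinAt_nonpos (convex_Icc 0 1)
    continuous_ellipseCos.continuousOn (f' := fun k ↦ -(k * ellipseSlope k)) ?_ ?_ <;>
  rw [interior_Icc]
  · exact fun k hk ↦ (hasDerivAt_ellipseCos hk).hasDerivWithinAt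
  · exact fun k hk ↦ neg_nonpos.2 (mul_nonneg hk.1.le (ellipseSlope_nonneg k))

lemma one_le_ellipseCos {k : ℝ} (hk : k ∈ Icc (0 : ℝ) 1) : 1 ≤ ellipseCos k :=
  ellipseCos_one ▸ antitoneOn_ellipseCos hk (right_mem_Icc.2 zero_le_one) hk.2

lemma ellipseSin_nonneg {k : ℝ} (hk : k ∈ Icc (0 : ℝ) 1) : 0 ≤ ellipseSin k :=
  ellipseSin_zero ▸ monotoneOn_ellipseSin (left_mem_Icc.2 zero_le_one) hk hk.1

/-! ### Riccati comparison and growth of the quartic form. -/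

/-- The Riccati equation for the quotient of the two coefficients. -/
lemma hasDerivAt_ellipseSin_div_ellipseCos {k : ℝ} (hk : k ∈ Ioo (0 : ℝ) 1) :
    HasDerivAt (fun k ↦ ellipseSin k / ellipseCos k)
      (ellipseSin k / ellipseCos k / k
        - (1 - (ellipseSin k / ellipseCos k) ^ 2) / (1 - k ^ 2)) k := by
  have hP : 0 < ellipseCos k := one_pos.trans_le (one_le_ellipseCos (Ioo_subset_Icc_self hk))
  have h1 : 0 < 1 - k ^ 2 := by nlinarith [hk.1, hk.2]
  have hk0 := hk.1
  refine ((hasDerivAt_ellipseSin hk).div (hasDerivAt_ellipseCos hk) hP.ne').congr_deriv ?_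
  have hJ : ellipseSlope k = (ellipseSin k / k - ellipseCos k) / (1 - k ^ 2) := by
    rw [← one_sub_sq_mul_ellipseSlope hk0.ne', mul_div_cancel_left₀ _ h1.ne']
  rw [hJ]
  field_simp
  ring

/-- The first factor is H'(r) for H(r) = r(1 + 3r²)/(3 + r²), and the second is the Riccati
right-hand side. Thus H(r(k)) - k cannot increase where it is negative. -/
lemma riccati_comparison {k r : ℝ} (hk0 : 0 < k) (hk1 : k < 1) (hr0 : 0 ≤ r)
    (h : r * (1 + 3 * r ^ 2) / (3 + r ^ 2) < k) :
    (3 + 26 * r ^ 2 + 3 * r ^ 4) / (3 + r ^ 2) ^ 2 * (r / k - (1 - r ^ 2) / (1 - k ^ 2)) ≤ 1 := by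
  have hk2 : 0 < 1 - k ^ 2 := by nlinarith
  have hd : 0 < 3 + r ^ 2 := by positivity
  rw [div_lt_iff₀ hd] at h
  have h1 : r / k ≤ (3 + r ^ 2) / (1 + 3 * r ^ 2) := by
    rw [div_le_div_iff₀ hk0 (by positivity)]; linarith
  -- The left side is (1 - r²)/(1 - H(r)²) with the common factor 1 - r² cancelled.
  have h2 : (3 + r ^ 2) ^ 2 / (9 + 14 * r ^ 2 + 9 * r ^ 4) ≤ (1 - r ^ 2) / (1 - k ^ 2) := by
    rw [div_le_div_iff₀ (by positivity) hk2]
    have : (r * (1 + 3 * r ^ 2)) ^ 2 ≤ (k * (3 + r ^ 2)) ^ 2 := by gcongr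
    nlinarith
  have h3 : r / k - (1 - r ^ 2) / (1 - k ^ 2) ≤
      2 * (3 + r ^ 2) * (3 + 2 * r ^ 2 + 3 * r ^ 4)
        / ((1 + 3 * r ^ 2) * (9 + 14 * r ^ 2 + 9 * r ^ 4)) := by
    refine (sub_le_sub h1 h2).trans_eq ?_
    field_simp
    ring
  refine (mul_le_mul_of_nonneg_left h3 (by positivity)).trans ?_
  rw [div_mul_div_comm, div_le_one (by positivity)]
  -- This is exactly the denominator minus the numerator of the remaining fraction.
  have : 0 ≤ (3 + r ^ 2) * (9 * (1 - r ^ 2) ^ 4) := by positivity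
  nlinarith

/-- From a negative value, w is nonincreasing up to its next zero, which exists because w 1 = 0; it
would have to rise to reach that zero. -/
lemma le_of_antitone_where_neg {w w' : ℝ → ℝ} (hc : ContinuousOn w (Icc 0 1)) (h1 : w 1 = 0)
    (hd : ∀ k ∈ Ioo (0 : ℝ) 1, HasDerivAt w (w' k) k)
    (hw : ∀ k ∈ Ioo (0 : ℝ) 1, w k < 0 → w' k ≤ 0) {k : ℝ} (hk : k ∈ Ioo (0 : ℝ) 1) :
    0 ≤ w k := by
  by_contra! hneg
  let S := Icc k 1 ∩ w ⁻¹' {0}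
  have hsub : Icc k 1 ⊆ Icc 0 1 := Icc_subset_Icc_left hk.1.le
  have hSc : IsClosed S := (hc.mono hsub).preimage_isClosed_of_isClosed isClosed_Icc isClosed_singleton
  have hSn : S.Nonempty := ⟨1, ⟨hk.2.le, le_rfl⟩, h1⟩
  have hSb : BddBelow S := ⟨k, fun x hx ↦ hx.1.1⟩
  have hm : sInf S ∈ S := hSc.csInf_mem hSn hSb
  set m := sInf S
  have hlt : ∀ x ∈ Ico k m, w x < 0 := by
    intro x hx
    by_contra! hx0
    have : (0 : ℝ) ∈ w '' Icc k x := intermediate_value_Icc hx.1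
      (hc.mono ((Icc_subset_Icc_right (hx.2.le.trans hm.1.2)).trans hsub)) ⟨hneg.le, hx0⟩
    obtain ⟨y, hy, hy0⟩ := this
    have hyS : y ∈ S := ⟨⟨hy.1, hy.2.trans (hx.2.le.trans hm.1.2)⟩, hy0⟩
    linarith [csInf_le hSb hyS, hy.2, hx.2]
  have hanti : AntitoneOn w (Icc k m) := by
    refine antitoneOn_of_hasDerivWithinAt_nonpos (convex_Icc k m)
      (hc.mono ((Icc_subset_Icc_right hm.1.2).trans hsub)) (f' := w') ?_ ?_ <;>
    rw [interior_Icc]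
    · exact fun x hx ↦ (hd x ⟨hk.1.trans hx.1, hx.2.trans_le hm.1.2⟩).hasDerivWithinAt
    · exact fun x hx ↦ hw x ⟨hk.1.trans hx.1, hx.2.trans_le hm.1.2⟩ (hlt x ⟨hx.1.le, hx.2⟩)
  have := hanti (left_mem_Icc.2 hm.1.1) (right_mem_Icc.2 hm.1.1) hm.1.1
  have hm0 : w m = 0 := hm.2
  linarith

/-- This is k ≤ H(r) multiplied by P³(3 + r²); it is the sign condition for the derivative of the
quartic form. -/
lemma mul_le_of_ellipse {k : ℝ} (hk : k ∈ Ioo (0 : ℝ) 1) :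
    k * (3 * ellipseCos k ^ 3 + ellipseCos k * ellipseSin k ^ 2) ≤
      ellipseCos k ^ 2 * ellipseSin k + 3 * ellipseSin k ^ 3 := by
  set r : ℝ → ℝ := fun k ↦ ellipseSin k / ellipseCos k with hr
  have hP : ∀ k ∈ Icc (0 : ℝ) 1, 0 < ellipseCos k :=
    fun k hk ↦ one_pos.trans_le (one_le_ellipseCos hk)
  have hrc : ContinuousOn r (Icc 0 1) := continuous_ellipseSin.continuousOn.div
    continuous_ellipseCos.continuousOn fun k hk ↦ (hP k hk).ne'
  have h := le_of_antitone_where_neg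
    (w := fun k ↦ r k * (1 + 3 * r k ^ 2) / (3 + r k ^ 2) - k)
    (w' := fun k ↦ (3 + 26 * r k ^ 2 + 3 * r k ^ 4) / (3 + r k ^ 2) ^ 2
      * (r k / k - (1 - r k ^ 2) / (1 - k ^ 2)) - 1) ?_ ?_ ?_ ?_ hk
  · have hPk := hP k (Ioo_subset_Icc_self hk)
    have h2 : k ≤ r k * (1 + 3 * r k ^ 2) / (3 + r k ^ 2) := sub_nonneg.1 h
    rw [le_div_iff₀ (by positivity)] at h2
    have hs : ellipseSin k = r k * ellipseCos k := by
      simp only [hr]; field_simp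
    rw [hs]
    have := mul_le_mul_of_nonneg_right h2 (pow_pos hPk 3).le
    linarith
  · exact ((hrc.mul (by fun_prop)).div (by fun_prop) fun k _ ↦ by positivity).sub continuousOn_id
  · simp [hr, ellipseCos_one, ellipseSin_one]; norm_num
  · intro k hk
    have hd : HasDerivAt r (r k / k - (1 - r k ^ 2) / (1 - k ^ 2)) k :=
      hasDerivAt_ellipseSin_div_ellipseCos hk
    have hH : HasDerivAt (fun r : ℝ ↦ r * (1 + 3 * r ^ 2) / (3 + r ^ 2))
        ((3 + 26 * r k ^ 2 + 3 * r k ^ 4) / (3 + r k ^ 2) ^ 2) (r k) := by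
      have e : 3 + r k ^ 2 ≠ 0 := by positivity
      refine (((hasDerivAt_id' (r k)).mul
        (((hasDerivAt_pow 2 (r k)).const_mul 3).const_add 1)).div
        ((hasDerivAt_pow 2 (r k)).const_add 3) e).congr_deriv ?_
      simp only [Pi.mul_apply]
      push_cast
      ring
    exact (hH.comp k hd).sub (hasDerivAt_id' k)
  · intro k hk hneg
    have hk' := Ioo_subset_Icc_self hk
    have hr0 : 0 ≤ r k := div_nonneg (ellipseSin_nonneg hk') (hP k hk').le
    exact sub_nonpos.2 (riccati_comparison hk.1 hk.2 hr0 (sub_neg.1 hneg))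

lemma monotoneOn_ellipse_quartic : MonotoneOn
    (fun k ↦ 3 * ellipseCos k ^ 4 + 2 * ellipseCos k ^ 2 * ellipseSin k ^ 2 + 3 * ellipseSin k ^ 4)
    (Icc 0 1) := by
  have hc := continuous_ellipseCos
  have hs := continuous_ellipseSin
  refine monotoneOn_of_hasDerivWithinAt_nonneg (convex_Icc 0 1)
    (by fun_prop) (f' := fun k ↦ 4 * ellipseSlope k *
      (ellipseCos k ^ 2 * ellipseSin k + 3 * ellipseSin k ^ 3
        - k * (3 * ellipseCos k ^ 3 + ellipseCos k * ellipseSin k ^ 2))) ?_ ?_ <;>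
  rw [interior_Icc] <;> intro k hk
  · have hP := hasDerivAt_ellipseCos hk
    have hQ := hasDerivAt_ellipseSin hk
    refine HasDerivAt.hasDerivWithinAt ?_
    refine ((((hP.pow 4).const_mul 3).add (((hP.pow 2).const_mul 2).mul (hQ.pow 2))).add
      ((hQ.pow 4).const_mul 3)).congr_deriv ?_
    simp only [Pi.pow_apply]
    push_cast
    ring
  · exact mul_nonneg (mul_nonneg (by norm_num) (ellipseSlope_nonneg k))
      (sub_nonneg.2 (mul_le_of_ellipse hk))

lemma le_ellipse_quartic {k : ℝ} (hk : k ∈ Icc (-1 : ℝ) 1) :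
    768 / π ^ 4 ≤
      3 * ellipseCos k ^ 4 + 2 * ellipseCos k ^ 2 * ellipseSin k ^ 2 + 3 * ellipseSin k ^ 4 := by
  wlog h0 : 0 ≤ k generalizing k
  · have := this (k := -k) ⟨by linarith [hk.2], by linarith [hk.1]⟩ (by linarith)
    rw [ellipseCos_neg, ellipseSin_neg] at this
    exact this.trans_eq (by ring)
  have := monotoneOn_ellipse_quartic (left_mem_Icc.2 zero_le_one) ⟨h0, hk.2⟩ h0
  refine le_trans (le_of_eq ?_) this
  simp only [ellipseCos_zero, ellipseSin_zero]
  ring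

/-! ### Poisson extension and Wirtinger derivatives. -/

lemma ContinuousLinearMap.intervalIntegrable_comp_of {E F : Type*} [NormedAddCommGroup E]
    [NormedSpace ℝ E] [NormedAddCommGroup F] [NormedSpace ℝ F] (L : E →L[ℝ] F) {f : ℝ → E}
    {a b : ℝ} (hf : IntervalIntegrable f volume a b) :
    IntervalIntegrable (fun x ↦ L (f x)) volume a b :=
  ⟨L.integrable_comp hf.1, L.integrable_comp hf.2⟩

lemma norm_circleAverage_le_circleAverage {f : ℂ → ℂ} {b : ℂ → ℝ} {c : ℂ} {R : ℝ}
    (hb : CircleIntegrable b c R) (h : ∀ z ∈ sphere c |R|, ‖f z‖ ≤ b z) :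
    ‖Real.circleAverage f c R‖ ≤ Real.circleAverage b c R := by
  rw [Real.circleAverage, Real.circleAverage, norm_smul, Real.norm_of_nonneg (by positivity),
    smul_eq_mul]
  gcongr
  exact intervalIntegral.norm_integral_le_of_norm_le (by positivity)
    (Eventually.of_forall fun θ _ ↦ h _ (circleMap_mem_sphere' c R θ)) hb

open ComplexConjugate Complex in
/-- The Poisson extension of a bounded boundary function with mean zero, decomposed into a
holomorphic and an antiholomorphic part. -/
lemma exists_analytic_parts_of_boundary {g : ℂ → ℂ} (hg : CircleIntegrable g 0 1)
    (hb : ∀ ζ, ‖g ζ‖ ≤ 1) (h0 : Real.circleAverage g 0 1 = 0) :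
    ∃ H₁ H₂ : ℂ → ℂ, AnalyticOnNhd ℂ H₁ (ball 0 1) ∧ AnalyticOnNhd ℂ H₂ (ball 0 1) ∧
      HasDerivAt H₁ (Real.circleAverage (fun ζ ↦ g ζ / ζ) 0 1) 0 ∧
      HasDerivAt H₂ (Real.circleAverage (fun ζ ↦ conj (g ζ) / ζ) 0 1) 0 ∧
      H₁ 0 + conj (H₂ 0) = 0 ∧ ∀ z ∈ ball (0 : ℂ) 1, ‖H₁ z + conj (H₂ z)‖ < 1 := by
  have hgc : CircleIntegrable (fun ζ ↦ conj (g ζ)) 0 1 :=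
    (conjCLE : ℂ →L[ℝ] ℂ).intervalIntegrable_comp_of hg
  -- The factor 1/2 makes H g + conj (H (conj g)) the Poisson integral, since Re K = (K + conj K)/2.
  let H : (ℂ → ℂ) → ℂ → ℂ := fun g w ↦
    (1 / 2 : ℂ) * Real.circleAverage (fun ζ ↦ herglotzRieszKernel 0 w ζ • g ζ) 0 1
  have hmem0 : (0 : ℂ) ∈ ball (0 : ℂ) 1 := mem_ball_self one_pos
  have hH : ∀ g : ℂ → ℂ, CircleIntegrable g 0 1 → AnalyticOnNhd ℂ (H g) (ball 0 1) :=
    fun g hg ↦ analyticOnNhd_const.mul (analyticOnNhd_circleAverage_herglotzRieszKernel_smul hg)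
  have hH' : ∀ g : ℂ → ℂ, CircleIntegrable g 0 1 →
      HasDerivAt (H g) (Real.circleAverage (fun ζ ↦ g ζ / ζ) 0 1) 0 := by
    intro g hg
    refine ((hasDerivAt_circleAverage_herglotzRieszKernel_smul hg hmem0).const_mul
      (1 / 2 : ℂ)).congr_deriv ?_
    rw [← smul_eq_mul, ← Real.circleAverage_fun_smul]
    refine Real.circleAverage_congr_sphere fun ζ hζ ↦ ?_
    have : ζ ≠ 0 := ne_zero_of_mem_sphere (by norm_num) ⟨ζ, hζ⟩
    simp only [smul_eq_mul, sub_zero]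
    field_simp
  have hK : ∀ w ∈ ball (0 : ℂ) 1, ContinuousOn (herglotzRieszKernel 0 w) (sphere 0 |1|) :=
    fun w hw ↦ continuousOn_herglotzRieszKernel_sphere hw
  have hKg : ∀ w ∈ ball (0 : ℂ) 1, ∀ g : ℂ → ℂ, CircleIntegrable g 0 1 →
      CircleIntegrable (fun ζ ↦ herglotzRieszKernel 0 w ζ • g ζ) 0 1 :=
    fun w hw g hg ↦ hg.continuousOn_smul (hK w hw)
  have hrep : ∀ w ∈ ball (0 : ℂ) 1, H g w + conj (H (fun ζ ↦ conj (g ζ)) w) =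
      Real.circleAverage (fun ζ ↦ ((herglotzRieszKernel 0 w ζ).re : ℂ) * g ζ) 0 1 := by
    intro w hw
    have h1 := hKg w hw g hg
    have h2 := hKg w hw _ hgc
    have h3 : CircleIntegrable (fun ζ ↦ conj (herglotzRieszKernel 0 w ζ) * g ζ) 0 1 := by
      refine CircleIntegrable.continuousOn_mul (f := g) hg ?_
      exact (continuous_conj.comp_continuousOn (hK w hw))
    have hc : conj (Real.circleAverage
        (fun ζ ↦ herglotzRieszKernel 0 w ζ • conj (g ζ)) 0 1) =
        Real.circleAverage (fun ζ ↦ conj (herglotzRieszKernel 0 w ζ) * g ζ) 0 1 := by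
      rw [← conjCLE_apply, ← ContinuousLinearEquiv.coe_coe,
        ← ContinuousLinearMap.circleAverage_comp_comm _ h2]
      congr 1 with ζ
      simp
    simp only [H, map_mul, hc]
    rw [show conj (1 / 2 : ℂ) = 1 / 2 by simp [map_ofNat], ← mul_add,
      ← Real.circleAverage_fun_add h1 h3, ← smul_eq_mul, ← Real.circleAverage_fun_smul]
    congr 1 with ζ
    rw [re_eq_add_conj]
    simp only [smul_eq_mul]
    ring
  refine ⟨H g, H fun ζ ↦ conj (g ζ), hH _ hg, hH _ hgc, hH' _ hg, hH' _ hgc, ?_, ?_⟩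
  · rw [hrep 0 hmem0]
    refine Eq.trans ?_ h0
    refine Real.circleAverage_congr_sphere fun ζ hζ ↦ ?_
    have : ζ ≠ 0 := ne_zero_of_mem_sphere (by norm_num) ⟨ζ, hζ⟩
    simp [herglotzRieszKernel_def, this]
  · intro w hw
    have hw1 : ‖w‖ < 1 := by simpa using hw
    -- Harnack's lower bound for the Poisson kernel. As g has mean zero, m can be subtracted from
    -- the kernel at no cost; the remaining mass 1 - m gives the strict inequality.
    set m : ℝ := (1 - ‖w‖) / (1 + ‖w‖)
    have hm : 0 < m := div_pos (by linarith) (by positivity)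
    have hre : ContinuousOn (fun ζ ↦ (herglotzRieszKernel 0 w ζ).re) (sphere 0 |1|) :=
      continuous_re.comp_continuousOn (hK w hw)
    have hrei : CircleIntegrable (fun ζ ↦ (herglotzRieszKernel 0 w ζ).re) 0 1 :=
      hre.circleIntegrable'
    have hone : Real.circleAverage (fun ζ ↦ (herglotzRieszKernel 0 w ζ).re) 0 1 = 1 := by
      have := HarmonicOnNhd.circleAverage_re_herglotzRieszKernel_smul (R := 1) (c := 0)
        (harmonicOnNhd_const (1 : ℝ)) hw
      rw [← this]
      congr 1 with ζ
      simp
    have hsplit : Real.circleAverage (fun ζ ↦ ((herglotzRieszKernel 0 w ζ).re : ℂ) * g ζ) 0 1 =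
        Real.circleAverage (fun ζ ↦ (((herglotzRieszKernel 0 w ζ).re - m : ℝ) : ℂ) * g ζ) 0 1 := by
      have e : Real.circleAverage (fun ζ ↦ (m : ℂ) • g ζ) 0 1 = 0 := by
        rw [Real.circleAverage_fun_smul, h0, smul_zero]
      refine (sub_eq_self.2 e).symm.trans ?_
      rw [← Real.circleAverage_fun_sub]
      · congr 1 with ζ
        push_cast
        simp only [smul_eq_mul]
        ring
      · exact hg.continuousOn_mul (continuous_ofReal.comp_continuousOn hre)
      · exact hg.const_smul
    have hmK : CircleIntegrable (fun ζ ↦ (herglotzRieszKernel 0 w ζ).re - m) 0 1 :=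
      hrei.sub (circleIntegrable_const m 0 1)
    rw [hrep w hw, hsplit]
    refine (norm_circleAverage_le_circleAverage hmK fun ζ hζ ↦ ?_).trans_lt ?_
    · have hle : m ≤ (herglotzRieszKernel 0 w ζ).re := by
        have := le_re_herglotzRieszKernel (R := 1) (c := 0) (by simpa using hζ) hw
        simpa [herglotzRieszKernel_def] using this
      rw [norm_mul, norm_real, Real.norm_of_nonneg (sub_nonneg.2 hle)]
      exact mul_le_of_le_one_right (sub_nonneg.2 hle) (hb ζ)
    · rw [Real.circleAverage_fun_sub hrei (circleIntegrable_const m 0 1), hone,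
        Real.circleAverage_const]
      linarith

open ComplexConjugate Complex in
lemma wirtinger_add_conj {h₁ h₂ : ℂ → ℂ} {a b z : ℂ} (d₁ : HasDerivAt h₁ a z)
    (d₂ : HasDerivAt h₂ b z) :
    wirtinger (fun w ↦ h₁ w + conj (h₂ w)) z = a ∧
      wirtingerBar (fun w ↦ h₁ w + conj (h₂ w)) z = conj b := by
  have h := (d₁.hasFDerivAt.restrictScalars ℝ).add
    ((conjCLE : ℂ →L[ℝ] ℂ).hasFDerivAt.comp z (d₂.hasFDerivAt.restrictScalars ℝ))
  have h' : HasFDerivAt (fun w ↦ h₁ w + conj (h₂ w)) _ z := h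
  have e := Complex.I_mul_I
  constructor
  · rw [wirtinger, h'.fderiv]
    simp
    linear_combination (-a / 2 + conj b / 2) * e
  · rw [wirtingerBar, h'.fderiv]
    simp
    linear_combination (a / 2 - conj b / 2) * e

open ComplexConjugate Complex in
lemma harmonicOnNhd_add_conj {h₁ h₂ : ℂ → ℂ} {s : Set ℂ} (a₁ : AnalyticOnNhd ℂ h₁ s)
    (a₂ : AnalyticOnNhd ℂ h₂ s) : HarmonicOnNhd (fun w ↦ h₁ w + conj (h₂ w)) s :=
  fun z hz ↦ (a₁ z hz).harmonicAt.add (a₂ z hz).harmonicAt_conj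

/-! ### Ellipse maps and their Fourier coefficients. -/

/-- The normalized ellipse parametrization as a function on the plane. -/
noncomputable def ellipseMap (k : ℝ) (ζ : ℂ) : ℂ :=
  (ζ.re + k * ζ.im * Complex.I) / (√(ζ.re ^ 2 + k ^ 2 * ζ.im ^ 2) : ℝ)

lemma norm_ellipseMap_le (k : ℝ) (ζ : ℂ) : ‖ellipseMap k ζ‖ ≤ 1 := by
  rw [ellipseMap, norm_div, Complex.norm_real, Real.norm_of_nonneg (Real.sqrt_nonneg _)]
  refine div_le_one_of_le₀ (le_of_eq ?_) (Real.sqrt_nonneg _)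
  rw [← Complex.ofReal_mul, Complex.norm_add_mul_I, mul_pow]

lemma measurable_ellipseMap (k : ℝ) : Measurable (ellipseMap k) := by
  unfold ellipseMap; fun_prop

lemma ellipseMap_neg (k : ℝ) (ζ : ℂ) : ellipseMap k (-ζ) = -ellipseMap k ζ := by
  simp [ellipseMap]; ring

lemma ellipseMap_circleMap (k θ : ℝ) : ellipseMap k (circleMap 0 1 θ) =
    (Real.cos θ + k * Real.sin θ * Complex.I) / ellipseRadius k θ := by
  have hre : (circleMap 0 1 θ).re = Real.cos θ := by
    simp [circleMap, Complex.exp_ofReal_mul_I_re]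
  have him : (circleMap 0 1 θ).im = Real.sin θ := by
    simp [circleMap, Complex.exp_ofReal_mul_I_im]
  rw [ellipseMap, hre, him, ellipseRadius]

lemma circleIntegrable_ellipseMap (k : ℝ) : CircleIntegrable (ellipseMap k) 0 1 := by
  refine IntervalIntegrable.mono_fun' (g := fun _ ↦ 1) intervalIntegrable_const ?_
    (Eventually.of_forall fun θ ↦ norm_ellipseMap_le k _)
  exact ((measurable_ellipseMap k).comp (measurable_circleMap 0 1)).aestronglyMeasurable

/-- Rotation by π preserves the circle average and changes the sign of f. -/
lemma circleAverage_eq_zero_of_odd {f : ℂ → ℂ} {R : ℝ} (hf : ∀ z, f (-z) = -f z) :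
    Real.circleAverage f 0 R = 0 := by
  have h : Real.circleAverage f 0 R = -Real.circleAverage f 0 R := by
    conv_lhs => rw [Real.circleAverage_eq_integral_add π]
    rw [Real.circleAverage, ← smul_neg, ← intervalIntegral.integral_neg]
    congr 2 with θ
    rw [← hf]
    congr 1
    simp [circleMap, add_mul, Complex.exp_add]
  exact self_eq_neg.1 h

lemma integral_sin_mul_cos_div_ellipseRadius (k : ℝ) :
    ∫ θ in (0 : ℝ)..2 * π, Real.sin θ * Real.cos θ / ellipseRadius k θ = 0 := by
  have h := intervalIntegral.integral_comp_sub_left (a := 0) (b := 2 * π)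
    (fun θ ↦ Real.sin θ * Real.cos θ / ellipseRadius k θ) (2 * π)
  have e : ∀ θ, ellipseRadius k (2 * π - θ) = ellipseRadius k θ := fun θ ↦ by
    simp [ellipseRadius]
  simp only [e, Real.sin_two_pi_sub, Real.cos_two_pi_sub, neg_mul, neg_div, sub_zero, sub_self,
    intervalIntegral.integral_neg] at h
  linarith

lemma intervalIntegrable_cos_sq_div_ellipseRadius (k : ℝ) :
    IntervalIntegrable (fun θ ↦ Real.cos θ ^ 2 / ellipseRadius k θ) volume 0 (2 * π) :=
  IntervalIntegrable.mono_fun' (g := fun _ ↦ 1) intervalIntegrable_const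
    ((by fun_prop : Measurable fun θ : ℝ ↦ Real.cos θ ^ 2).div
      (continuous_ellipseRadius k).measurable).aestronglyMeasurable
    (Eventually.of_forall fun θ ↦ abs_cos_sq_div_ellipseRadius_le k θ)

lemma intervalIntegrable_mul_sin_sq_div_ellipseRadius (k : ℝ) :
    IntervalIntegrable (fun θ ↦ k * Real.sin θ ^ 2 / ellipseRadius k θ) volume 0 (2 * π) :=
  IntervalIntegrable.mono_fun' (g := fun _ ↦ 1) intervalIntegrable_const
    ((by fun_prop : Measurable fun θ : ℝ ↦ k * Real.sin θ ^ 2).div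
      (continuous_ellipseRadius k).measurable).aestronglyMeasurable
    (Eventually.of_forall fun θ ↦ abs_mul_sin_sq_div_ellipseRadius_le k θ)

lemma intervalIntegrable_sin_mul_cos_div_ellipseRadius (k : ℝ) :
    IntervalIntegrable (fun θ ↦ Real.sin θ * Real.cos θ / ellipseRadius k θ) volume 0 (2 * π) := by
  refine IntervalIntegrable.mono_fun' (g := fun _ ↦ 1) intervalIntegrable_const
    ((by fun_prop : Measurable fun θ : ℝ ↦ Real.sin θ * Real.cos θ).div
      (continuous_ellipseRadius k).measurable).aestronglyMeasurable
    (Eventually.of_forall fun θ ↦ ?_)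
  simp only [Real.norm_eq_abs, abs_div, abs_of_nonneg (ellipseRadius_nonneg k θ), abs_mul]
  exact div_le_one_of_le₀ ((mul_le_of_le_one_left (abs_nonneg _) (Real.abs_sin_le_one θ)).trans
    (abs_cos_le_ellipseRadius k θ)) (ellipseRadius_nonneg k θ)

open Complex in
/-- The first Fourier coefficients of a map that on the circle is a real combination of
`cos ^ 2`, `sin ^ 2` and `sin * cos` over the radius of the ellipse. -/
lemma circleAverage_eq_of_ellipse {f : ℂ → ℂ} {k σ τ : ℝ}
    (h : ∀ θ, f (circleMap 0 1 θ) = ((Real.cos θ ^ 2 / ellipseRadius k θ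
      + σ * (k * Real.sin θ ^ 2 / ellipseRadius k θ) : ℝ) : ℂ)
      + ((τ * (Real.sin θ * Real.cos θ / ellipseRadius k θ) : ℝ) : ℂ) * I) :
    Real.circleAverage f 0 1 = ((ellipseCos k + σ * ellipseSin k) / 2 : ℝ) := by
  have i1 := intervalIntegrable_cos_sq_div_ellipseRadius k
  have i2 := (intervalIntegrable_mul_sin_sq_div_ellipseRadius k).const_mul σ
  have i3 := (intervalIntegrable_sin_mul_cos_div_ellipseRadius k).const_mul τ
  have j1 := ofRealCLM.intervalIntegrable_comp_of (i1.add i2)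
  have j2 := (ofRealCLM.intervalIntegrable_comp_of i3).mul_const I
  simp only [ofRealCLM_apply] at j1 j2
  rw [Real.circleAverage]
  simp only [h]
  rw [intervalIntegral.integral_add j1 j2,
    intervalIntegral.integral_mul_const, intervalIntegral.integral_ofReal,
    intervalIntegral.integral_ofReal, intervalIntegral.integral_add i1 i2,
    intervalIntegral.integral_const_mul, intervalIntegral.integral_const_mul,
    integral_sin_mul_cos_div_ellipseRadius, ellipseCos, ellipseSin, mul_zero, ofReal_zero,
    zero_mul, add_zero, real_smul, ← ofReal_mul]
  congr 1
  field_simp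

open ComplexConjugate Complex in
lemma circleAverage_ellipseMap_div (k : ℝ) :
    Real.circleAverage (fun ζ ↦ ellipseMap k ζ / ζ) 0 1 =
      ((ellipseCos k + ellipseSin k) / 2 : ℝ) := by
  rw [circleAverage_eq_of_ellipse (k := k) (σ := 1) (τ := k - 1), one_mul]
  intro θ
  rw [ellipseMap_circleMap, div_eq_mul_inv _ (circleMap 0 1 θ), circleMap_zero_inv, circleMap_zero]
  simp only [inv_one, ofReal_one, one_mul]
  rw [exp_mul_I, ofReal_neg, Complex.cos_neg, Complex.sin_neg]
  push_cast
  linear_combination (-k * Complex.sin θ ^ 2 / (ellipseRadius k θ : ℂ)) * I_mul_I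

open ComplexConjugate Complex in
lemma circleAverage_conj_ellipseMap_div (k : ℝ) :
    Real.circleAverage (fun ζ ↦ conj (ellipseMap k ζ) / ζ) 0 1 =
      ((ellipseCos k - ellipseSin k) / 2 : ℝ) := by
  rw [circleAverage_eq_of_ellipse (k := k) (σ := -1) (τ := -k - 1), neg_one_mul, sub_eq_add_neg]
  intro θ
  rw [ellipseMap_circleMap, div_eq_mul_inv _ (circleMap 0 1 θ), circleMap_zero_inv, circleMap_zero]
  simp only [inv_one, ofReal_one, one_mul, map_div₀, map_add, map_mul, conj_ofReal, conj_I]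
  rw [exp_mul_I, ofReal_neg, Complex.cos_neg, Complex.sin_neg]
  push_cast
  linear_combination (k * Complex.sin θ ^ 2 / (ellipseRadius k θ : ℂ)) * I_mul_I

open ComplexConjugate Complex in
/-- The harmonic self-map of the disk attached to the ellipse of parameter `k`, up to rotations
and contractions. -/
lemma exists_harmonic_of_ellipse (k : ℝ) {c u : ℂ} (hc : ‖c‖ ≤ 1) (hu : ‖u‖ = 1) :
    ∃ f : ℂ → ℂ, HarmonicOnNhd f (ball 0 1) ∧ MapsTo f (ball 0 1) (ball 0 1) ∧ f 0 = 0 ∧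
      wirtinger f 0 = c * u * ((ellipseCos k + ellipseSin k) / 2 : ℝ) ∧
      wirtingerBar f 0 = c * conj u * ((ellipseCos k - ellipseSin k) / 2 : ℝ) := by
  obtain ⟨H₁, H₂, a₁, a₂, d₁, d₂, h0, hlt⟩ := exists_analytic_parts_of_boundary
    (circleIntegrable_ellipseMap k) (norm_ellipseMap_le k)
    (circleAverage_eq_zero_of_odd (ellipseMap_neg k))
  rw [circleAverage_ellipseMap_div] at d₁
  rw [circleAverage_conj_ellipseMap_div] at d₂
  have hmaps : MapsTo (u * ·) (ball (0 : ℂ) 1) (ball 0 1) := fun z hz ↦ by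
    simpa [hu] using hz
  have hmul : AnalyticOnNhd ℂ (u * ·) (ball (0 : ℂ) 1) := analyticOnNhd_const.mul analyticOnNhd_id
  have hdm : HasDerivAt (u * ·) u (0 : ℂ) := by simpa using (hasDerivAt_id (0 : ℂ)).const_mul u
  have e₁ : HasDerivAt (fun z ↦ c * H₁ (u * z))
      (c * (((ellipseCos k + ellipseSin k) / 2 : ℝ) * u)) 0 := by
    refine HasDerivAt.const_mul c (HasDerivAt.comp (h₂ := H₁) (0 : ℂ) ?_ hdm)
    simpa using d₁
  have e₂ : HasDerivAt (fun z ↦ conj c * H₂ (u * z))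
      (conj c * (((ellipseCos k - ellipseSin k) / 2 : ℝ) * u)) 0 := by
    refine HasDerivAt.const_mul (conj c) (HasDerivAt.comp (h₂ := H₂) (0 : ℂ) ?_ hdm)
    simpa using d₂
  have hfac : ∀ z, c * H₁ (u * z) + conj (conj c * H₂ (u * z)) =
      c * (H₁ (u * z) + conj (H₂ (u * z))) := fun z ↦ by
    rw [map_mul, conj_conj]; ring
  obtain ⟨w₁, w₂⟩ := wirtinger_add_conj e₁ e₂
  refine ⟨fun z ↦ c * H₁ (u * z) + conj (conj c * H₂ (u * z)),
    harmonicOnNhd_add_conj (analyticOnNhd_const.mul (a₁.comp hmul hmaps))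
      (analyticOnNhd_const.mul (a₂.comp hmul hmaps)), fun z hz ↦ ?_, ?_, ?_, ?_⟩
  · rw [mem_ball_zero_iff]
    simp only [hfac, norm_mul]
    exact (mul_le_of_le_one_left (norm_nonneg _) hc).trans_lt (hlt _ (hmaps hz))
  · simp only [hfac]
    rw [mul_zero, h0, mul_zero]
  · rw [w₁]; ring
  · rw [w₂, map_mul, map_mul, conj_conj, conj_ofReal]; ring

/-! ### Gradient bound and sharpness. -/

open Complex in
/-- The gradient estimate at the center of a disk for a real harmonic function bounded by one. -/
lemma fderiv_one_le_of_harmonic {u : ℂ → ℝ} {r : ℝ} (hr : 0 < r)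
    (hu : HarmonicOnNhd u (closedBall 0 r)) (hb : ∀ z ∈ closedBall (0 : ℂ) r, |u z| ≤ 1) :
    fderiv ℝ u 0 1 ≤ 4 / (π * r) := by
  have hcs : ContinuousOn u (sphere 0 |r|) := by
    rw [abs_of_pos hr]; exact hu.continuousOn.mono sphere_subset_closedBall
  have hci : CircleIntegrable u 0 r := hcs.circleIntegrable'
  have hci' : CircleIntegrable (fun ζ ↦ (u ζ : ℂ)) 0 r :=
    (continuous_ofReal.comp_continuousOn hcs).circleIntegrable'
  have hmem0 : (0 : ℂ) ∈ ball (0 : ℂ) r := mem_ball_self hr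
  set H : ℂ → ℂ := fun w ↦
    Real.circleAverage (fun ζ ↦ herglotzRieszKernel 0 w ζ • (u ζ : ℂ)) 0 r
  have hH : HasDerivAt H
      (Real.circleAverage (fun ζ ↦ (2 * ζ / (ζ - 0) ^ 2) • (u ζ : ℂ)) 0 r) 0 :=
    hasDerivAt_circleAverage_herglotzRieszKernel_smul hci' hmem0
  have heq : u =ᶠ[𝓝 0] fun w ↦ (H w).re := by
    filter_upwards [isOpen_ball.mem_nhds hmem0] with w hw
    rw [re_circleAverage_herglotzRieszKernel_smul hci hw,
      HarmonicOnNhd.circleAverage_re_herglotzRieszKernel_smul hu hw]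
  have hd : HasFDerivAt (fun w ↦ (H w).re) _ 0 :=
    reCLM.hasFDerivAt.comp (0 : ℂ) (hH.hasFDerivAt.restrictScalars ℝ)
  have hne : ∀ ζ ∈ sphere (0 : ℂ) |r|, ζ ≠ 0 :=
    fun ζ hζ ↦ ne_zero_of_mem_sphere (abs_pos.2 hr.ne').ne' ⟨ζ, hζ⟩
  have hint : CircleIntegrable (fun ζ ↦ (2 * ζ / (ζ - 0) ^ 2) • (u ζ : ℂ)) 0 r := by
    have hk : ContinuousOn (fun ζ : ℂ ↦ 2 * ζ / (ζ - 0) ^ 2) (sphere 0 |r|) :=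
      ContinuousOn.div (by fun_prop) (by fun_prop) fun ζ hζ ↦ by simpa using hne ζ hζ
    exact hci'.continuousOn_smul hk
  rw [heq.fderiv_eq, hd.fderiv]
  simp only [ContinuousLinearMap.coe_comp, Function.comp_apply, reCLM_apply,
    ContinuousLinearMap.coe_restrictScalars', ContinuousLinearMap.toSpanSingleton_apply, one_smul]
  rw [← reCLM_apply, ← reCLM.circleAverage_comp_comm hint, Real.circleAverage, smul_eq_mul]
  -- On the circle the kernel 2ζ/ζ² equals (2/r)e^{-iθ}, whose real part has modulus (2/r)|cos θ|.
  have hle : ∫ θ in (0 : ℝ)..2 * π, (reCLM ∘ fun ζ ↦ (2 * ζ / (ζ - 0) ^ 2) • (u ζ : ℂ))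
      (circleMap 0 r θ) ≤ ∫ θ in (0 : ℝ)..2 * π, 2 / r * |Real.cos θ| := by
    refine intervalIntegral.integral_mono_on (by positivity) ?_
      ((Real.continuous_cos.abs.const_mul _).intervalIntegrable _ _) fun θ _ ↦ ?_
    · exact reCLM.intervalIntegrable_comp_of hint
    · have hz : circleMap 0 r θ ∈ closedBall (0 : ℂ) r :=
        circleMap_mem_closedBall 0 hr.le θ
      have e : 2 * circleMap 0 r θ / (circleMap 0 r θ - 0) ^ 2 =
          (2 / r : ℝ) * (circleMap 0 1 (-θ)) := by
        have h1 : circleMap 0 r θ ≠ 0 := by simpa using hr.ne'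
        have h2 : (circleMap 0 r θ)⁻¹ = (r⁻¹ : ℝ) * circleMap 0 1 (-θ) := by
          rw [circleMap_zero_inv]; simp [circleMap_zero]
        rw [sub_zero, pow_two, mul_div_mul_right _ _ h1, div_eq_mul_inv, h2]
        push_cast
        ring
      have hre : (circleMap 0 1 (-θ)).re = Real.cos θ := by
        rw [circleMap_zero, ofReal_one, one_mul, exp_ofReal_mul_I_re, Real.cos_neg]
      simp only [Function.comp_apply, reCLM_apply, e, smul_eq_mul]
      rw [mul_assoc, re_ofReal_mul, re_mul_ofReal, hre]
      refine mul_le_mul_of_nonneg_left ((le_abs_self _).trans ?_) (by positivity)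
      rw [abs_mul]
      exact mul_le_of_le_one_right (abs_nonneg _) (hb _ hz)
  rw [intervalIntegral.integral_const_mul, integral_abs_cos] at hle
  refine (mul_le_mul_of_nonneg_left hle (by positivity)).trans_eq ?_
  field_simp

open Complex in
lemma le_of_harmonic_of_wirtinger_eq {f : ℂ → ℂ} {C : ℝ} (hf : HarmonicOnNhd f (ball 0 1))
    (hm : MapsTo f (ball 0 1) (ball 0 1)) (h₁ : wirtinger f 0 = C) (h₂ : wirtingerBar f 0 = C) :
    C ≤ 2 / π := by
  have hd : DifferentiableAt ℝ f 0 :=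
    (hf 0 (mem_ball_self one_pos)).1.differentiableAt two_ne_zero
  have hx : fderiv ℝ f 0 1 = 2 * C := by
    rw [wirtinger] at h₁
    rw [wirtingerBar] at h₂
    linear_combination h₁ + h₂
  have hre : fderiv ℝ (reCLM ∘ f) 0 1 = 2 * C := by
    rw [(reCLM.hasFDerivAt.comp 0 hd.hasFDerivAt).fderiv]
    simp [hx]
  -- Harmonicity is known only on the open disk, so the bound is taken on radius r < 1 and then r
  -- tends to 1.
  have hle : ∀ r ∈ Ioo (0 : ℝ) 1, C * r ≤ 2 / π := by
    intro r hr
    have hsub : closedBall (0 : ℂ) r ⊆ ball 0 1 := closedBall_subset_ball hr.2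
    have := fderiv_one_le_of_harmonic hr.1 ((hf.comp_CLM reCLM).mono hsub) fun z hz ↦
      (abs_re_le_norm _).trans (mem_ball_zero_iff.1 (hm (hsub hz))).le
    rw [hre, le_div_iff₀ (mul_pos Real.pi_pos hr.1)] at this
    rw [le_div_iff₀ Real.pi_pos]
    linarith
  have ht : Tendsto (fun r ↦ C * r) (𝓝[<] 1) (𝓝 (C * 1)) :=
    (tendsto_id.const_mul C).mono_left nhdsWithin_le_nhds
  rw [mul_one] at ht
  exact le_of_tendsto ht (by
    filter_upwards [Ioo_mem_nhdsLT (zero_lt_one' ℝ)] with r hr using hle r hr)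

/-! ### Filling the quartic ball and conclusion. -/

/-- Every pair of nonnegative numbers in the quartic ball is a contraction of the coefficients of
an ellipse map. -/
lemma exists_ellipse_of_quartic_le {a b : ℝ} (ha : 0 ≤ a) (hb : 0 ≤ b)
    (h : a ^ 4 + 4 * (a * b) ^ 2 + b ^ 4 ≤ 96 / π ^ 4) :
    ∃ k s : ℝ, 0 ≤ s ∧ s ≤ 1 ∧ a = s * ((ellipseCos k + ellipseSin k) / 2) ∧
      b = s * ((ellipseCos k - ellipseSin k) / 2) := by
  have hc : Continuous fun k ↦ (ellipseCos k + ellipseSin k) / 2 * b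
      - (ellipseCos k - ellipseSin k) / 2 * a := by
    have := continuous_ellipseCos
    have := continuous_ellipseSin
    fun_prop
  -- A zero of this determinant puts the curve point on the ray through (a, b); the endpoint values
  -- are -a and b.
  obtain ⟨k, hk, hk0⟩ : (0 : ℝ) ∈ (fun k ↦ (ellipseCos k + ellipseSin k) / 2 * b
      - (ellipseCos k - ellipseSin k) / 2 * a) '' Icc (-1) 1 := by
    refine intermediate_value_Icc (by norm_num) hc.continuousOn ⟨?_, ?_⟩
    · simp only [ellipseCos_neg, ellipseSin_neg, ellipseCos_one, ellipseSin_one]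
      linarith
    · simp only [ellipseCos_one, ellipseSin_one]
      linarith
  have hP : 0 < ellipseCos k := by
    rcases le_total 0 k with h0 | h0
    · exact one_pos.trans_le (one_le_ellipseCos ⟨h0, hk.2⟩)
    · rw [← ellipseCos_neg]
      exact one_pos.trans_le (one_le_ellipseCos ⟨by linarith, by linarith [hk.1]⟩)
  -- The two coordinates of the curve point add up to P, which fixes the scale.
  set s := (a + b) / ellipseCos k with hs
  have hs0 : 0 ≤ s := by positivity
  have ha' : a = s * ((ellipseCos k + ellipseSin k) / 2) := by
    simp only [hs]
    field_simp
    linear_combination -2 * hk0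
  have hb' : b = s * ((ellipseCos k - ellipseSin k) / 2) := by
    simp only [hs]
    field_simp
    linear_combination 2 * hk0
  refine ⟨k, s, hs0, ?_, ha', hb'⟩
  have hN := le_ellipse_quartic hk
  have hpos : 0 < 768 / π ^ 4 := by positivity
  have hmul : s ^ 4 * (3 * ellipseCos k ^ 4 + 2 * ellipseCos k ^ 2 * ellipseSin k ^ 2
      + 3 * ellipseSin k ^ 4) ≤ 768 / π ^ 4 := by
    calc _ = 8 * (a ^ 4 + 4 * (a * b) ^ 2 + b ^ 4) := by
          rw [ha', hb']; ring
      _ ≤ 8 * (96 / π ^ 4) := by gcongr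
      _ = 768 / π ^ 4 := by ring
  have hle : s ^ 4 ≤ 1 := by
    by_contra! hlt
    nlinarith
  exact (pow_le_one_iff_of_nonneg hs0 (by norm_num)).1 hle

open ComplexConjugate Complex in
/-- Two complex numbers can be given prescribed arguments by one rotation in the target and one
in the source. -/
lemma exists_rotation (α β : ℂ) : ∃ v u : ℂ, ‖v‖ = 1 ∧ ‖u‖ = 1 ∧
    α = ‖α‖ * (v * u) ∧ β = ‖β‖ * (v * conj u) := by
  refine ⟨exp (((arg α + arg β) / 2 : ℝ) * I), exp (((arg α - arg β) / 2 : ℝ) * I),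
    norm_exp_ofReal_mul_I _, norm_exp_ofReal_mul_I _, ?_, ?_⟩
  · rw [← exp_add]
    convert (norm_mul_exp_arg_mul_I α).symm using 3
    push_cast
    ring
  · rw [← exp_conj, map_mul, conj_ofReal, conj_I, ← exp_add]
    convert (norm_mul_exp_arg_mul_I β).symm using 3
    push_cast
    ring

theorem theorem2 :
    (∀ α β : ℂ,
      ((‖α‖ ^ 4 + 4 * ‖α * β‖ ^ 2 + ‖β‖ ^ 4) / 6 : ℝ) ^ (1 / 4 : ℝ) ≤ 2 / Real.pi →
      ∃ f : ℂ → ℂ, HarmonicOnNhd f (ball 0 1) ∧ Set.MapsTo f (ball 0 1) (ball 0 1) ∧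
        f 0 = 0 ∧ wirtinger f 0 = α ∧ wirtingerBar f 0 = β) ∧
    (∀ C : ℝ, 2 / Real.pi < C → ∃ α β : ℂ,
      ((‖α‖ ^ 4 + 4 * ‖α * β‖ ^ 2 + ‖β‖ ^ 4) / 6 : ℝ) ^ (1 / 4 : ℝ) ≤ C ∧
      ¬ ∃ f : ℂ → ℂ, HarmonicOnNhd f (ball 0 1) ∧ Set.MapsTo f (ball 0 1) (ball 0 1) ∧
        f 0 = 0 ∧ wirtinger f 0 = α ∧ wirtingerBar f 0 = β) := by
  refine ⟨fun α β h ↦ ?_, fun C hC ↦ ?_⟩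
  · have hroot : (1 / 4 : ℝ) = ((4 : ℕ) : ℝ)⁻¹ := by norm_num
    rw [hroot] at h
    have h4 := pow_le_pow_left₀ (by positivity) h 4
    rw [Real.rpow_inv_natCast_pow (by positivity) (by norm_num), norm_mul] at h4
    have hq : ‖α‖ ^ 4 + 4 * (‖α‖ * ‖β‖) ^ 2 + ‖β‖ ^ 4 ≤ 96 / Real.pi ^ 4 := by
      rw [div_pow] at h4
      linarith [show (2 : ℝ) ^ 4 / π ^ 4 * 6 = 96 / π ^ 4 by ring]
    obtain ⟨k, s, hs0, hs1, ha, hb⟩ :=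
      exists_ellipse_of_quartic_le (norm_nonneg α) (norm_nonneg β) hq
    obtain ⟨v, u, hv, hu, hα, hβ⟩ := exists_rotation α β
    obtain ⟨f, hf, hm, h0, h1, h2⟩ := exists_harmonic_of_ellipse k (c := s * v) (u := u)
      (by rw [norm_mul, hv, mul_one, Complex.norm_real, Real.norm_of_nonneg hs0]; exact hs1) hu
    refine ⟨f, hf, hm, h0, ?_, ?_⟩
    · rw [h1, hα, ha, Complex.ofReal_mul]; ring
    · rw [h2, hβ, hb, Complex.ofReal_mul]; ring
  · have hC0 : 0 ≤ C := le_trans (by positivity) hC.le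
    -- On the diagonal the normalized quartic mean of (C, C) is C itself.
    refine ⟨C, C, le_of_eq ?_, ?_⟩
    · rw [norm_mul, Complex.norm_real, Real.norm_of_nonneg hC0,
        show (C ^ 4 + 4 * (C * C) ^ 2 + C ^ 4) / 6 = C ^ 4 by ring,
        show (1 / 4 : ℝ) = ((4 : ℕ) : ℝ)⁻¹ by norm_num]
      exact Real.pow_rpow_inv_natCast hC0 (by norm_num)
    · rintro ⟨f, hf, hm, -, h1, h2⟩
      exact hC.not_ge (le_of_harmonic_of_wirtinger_eq hf hm h1 h2)
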